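/- Let $\Gamma$ be an infinite, locally finite tree with root $0$; let $|\sigma|$ be the distance from $0$ to $\sigma$, write $\sigma\le\tau$ if $\sigma$ lies on the path from $0$ to $\tau$, and for $\sigma\neq 0$ let $\overleftarrow{\sigma}$ be the neighbour of $\sigma$ on the path to $0$. Let a random environment be given: random nearest-neighbour transition probabilities $P(\sigma,\tau)$ on $\Gamma$, almost surely nonzero for all pairs of neighbours, whose vectors $P(\sigma,\cdot)$ at different vertices $\sigma$ are independent. For $|\sigma|\ge 2$ put $$A_\sigma = \frac{P(\overleftarrow{\sigma},\sigma)}{P(\overleftarrow{\sigma},\overleftarrow{\overleftarrow{\sigma}})},$$ and suppose that all but finitely many of these $A_\sigma$ have the law of one random variable $A$ with $0<A<\infty$ a.s. Let $p=\min_{0\le x\le 1}\mathbf{E}[A^x]$, and suppose that this minimum is attained at some $x\in(0,1]$ (which is automatic if $p<1$). A cutset is a finite set $\Pi$ of vertices that does not contain $0$, meets every infinite self-avoiding path from $0$, and has no two distinct elements $\sigma\le\tau$. Suppose that there are cutsets $\Pi_n$ with $\inf\{|\sigma| : \sigma\in\Pi_n\}\to\infty$ and $$\sup_n \sum_{\sigma\in\Pi_n}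 p^{|\sigma|}<\infty .$$ Then the random walk in this random environment is a.s. recurrent: for almost every environment, the Markov chain with transition probabilities $P$, started at any vertex, returns to that vertex with probability one. Moreover, let $A_\sigma$, $|\sigma|=1$, be any further a.s. positive random variables (for example independent copies of $A$), and put the conductance $C_\sigma=\prod_{0<\tau\le\sigma}A_\tau$ on the edge from $\overleftarrow{\sigma}$ to $\sigma$, for every $\sigma\ne 0$. Then a.s. this electrical network has zero conductance from $0$ to infinity: the total current that flows when a unit potential is imposed between $0$ and the vertices at level $n$ tends to $0$ as $n\to\infty$. -/

import Mathlib

open MeasureTheory ProbabilityTheory Filter Topology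
open scoped ENNReal

namespace TreeRWRE

/-! ### Rooted trees

`G` is a tree on the vertex set `V` and `o` is its root; `G.dist o σ` is the level `|σ|`. -/

section Tree

variable {V : Type*} (G : SimpleGraph V) (o : V)

/-- `σ ≤ τ`: the vertex `σ` lies on the (unique) path from the root `o` to `τ`. -/
def IsAncestor (σ τ : V) : Prop :=
  ∃ q : G.Walk o τ, q.IsPath ∧ σ ∈ q.support

open Classical in
/-- The predecessor of `σ`: the neighbour of `σ` that is one step closer to the root `o`.
(Only meaningful for `σ ≠ o`; the value at the root is `o`.) -/
noncomputable def parent (σ : V) : V :=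
  if h : ∃ w, G.Adj σ w ∧ G.dist o w + 1 = G.dist o σ then h.choose else σ

/-- The successors of `σ`: its neighbours that are one step further from the root. -/
noncomputable def successors [G.LocallyFinite] (σ : V) : Finset V :=
  (G.neighborFinset σ).filter fun τ => G.dist o τ = G.dist o σ + 1

/-- A cutset: a finite set of vertices, not containing the root, that meets every infinite
self-avoiding path from the root and has no two distinct comparable elements. -/
structure IsCutset (S : Finset V) : Prop where
  root_notMem : o ∉ S
  meets : ∀ r : ℕ → V, r 0 = o → (∀ n, G.Adj (r n) (r (n + 1))) → Function.Injective r →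
    ∃ n, r n ∈ S
  antichain : ∀ σ ∈ S, ∀ τ ∈ S, IsAncestor G o σ τ → σ = τ

end Tree

/-! ### Random walks (Markov chains) and recurrence -/

section Walk

variable {V : Type*}

/-- The one-step Markov kernel of the transition probabilities `K` (on a discrete space). -/
noncomputable def stepKernel [MeasurableSpace V] [DiscreteMeasurableSpace V] (K : V → PMF V) :
    Kernel V V where
  toFun v := (K v).toMeasure
  measurable' := Measurable.of_discrete

instance [MeasurableSpace V] [DiscreteMeasurableSpace V] (K : V → PMF V) :
    IsMarkovKernel (stepKernel K) :=
  ⟨fun v => inferInstanceAs (IsProbabilityMeasure (K v).toMeasure)⟩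

/-- The kernel that draws the state at time `n + 1` given the states up to time `n`. -/
noncomputable def historyKernel [MeasurableSpace V] [DiscreteMeasurableSpace V] (K : V → PMF V)
    (n : ℕ) : Kernel (Finset.Iic n → V) V :=
  (stepKernel K).comap (fun h => h ⟨n, Finset.mem_Iic.2 le_rfl⟩) (measurable_pi_apply _)

instance [MeasurableSpace V] [DiscreteMeasurableSpace V] (K : V → PMF V) (n : ℕ) :
    IsMarkovKernel (historyKernel K n) := by
  unfold historyKernel; infer_instance

/-- The law, on the space of trajectories `ℕ → V`, of the Markov chain with transition
probabilities `K` that starts at `v`. -/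
noncomputable def walkLaw [MeasurableSpace V] [DiscreteMeasurableSpace V] (K : V → PMF V) (v : V) :
    Measure (ℕ → V) :=
  Kernel.traj (X := fun _ => V) (historyKernel K) 0 fun _ => v

/-- The Markov chain with transition probabilities `K` is recurrent: from every starting vertex
it almost surely returns to that vertex. -/
def IsRecurrent (K : V → PMF V) : Prop :=
  letI : MeasurableSpace V := ⊤
  ∀ v : V, ∀ᵐ X ∂(walkLaw K v), ∃ n, 0 < n ∧ X n = v

end Walk

/-! ### Random environments -/

section Environment

variable {V : Type*} (G : SimpleGraph V) (o : V)

/-- For a vertex `σ` at distance at least two from the root, with predecessor `π`: the transition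
probability from `π` to `σ`, divided by the transition probability from `π` to its own
predecessor. -/
noncomputable def envRatio (K : V → PMF V) (σ : V) : ℝ :=
  (K (parent G o σ) σ / K (parent G o σ) (parent G o (parent G o σ))).toReal

/-- `P` is a random environment (a random choice of nearest-neighbour transition probabilities on
the tree `G`, defined on the probability space `(Ω, μ)`) whose ratios have common law `ν`. -/
structure IsRandomEnvironment {Ω : Type*} [MeasurableSpace Ω] (μ : Measure Ω)
    (P : Ω → V → PMF V) (ν : Measure ℝ) : Prop where
  /-- The transition probabilities are random variables. -/
  measurable : ∀ v w, Measurable fun ω => P ω v w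
  /-- Transitions are possible exactly between neighbours. -/
  support_eq : ∀ᵐ ω ∂μ, ∀ v, (P ω v).support = G.neighborSet v
  /-- The transition probability vectors at different vertices are independent. -/
  indep : iIndepFun (fun v ω (w : V) => P ω v w) μ
  /-- All but finitely many of the ratios have law `ν`. -/
  law : {σ : V | 2 ≤ G.dist o σ ∧ ¬ HasLaw (fun ω => envRatio G o (P ω) σ) ν μ}.Finite

/-- `E[A ^ x]`, for a positive random variable `A` with law `ν`. -/
noncomputable def moment (ν : Measure ℝ) (x : ℝ) : ℝ≥0∞ :=
  ∫⁻ a, ENNReal.ofReal (a ^ x) ∂ν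

/-- `p = min_{0 ≤ x ≤ 1} E[A ^ x]`. -/
noncomputable def minMoment (ν : Measure ℝ) : ℝ≥0∞ :=
  ⨅ x ∈ Set.Icc (0 : ℝ) 1, moment ν x

end Environment

/-! ### Electrical networks -/

section Network

variable {V : Type*} (G : SimpleGraph V) (o : V)

/-- The number `A_σ` (`σ ≠ o`): the ratio of transition probabilities if `|σ| ≥ 2`, and the freely
chosen number `B σ` if `|σ| = 1`. -/
noncomputable def edgeFactor (K : V → PMF V) (B : V → ℝ) (σ : V) : ℝ :=
  if G.dist o σ = 1 then B σ else envRatio G o K σ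

/-- `C_σ = ∏_{o < τ ≤ σ} A_τ`, the conductance of the edge that precedes `σ`; the vertices `τ` are
`σ`, its predecessor, and so on, down to level one. -/
noncomputable def conductance (K : V → PMF V) (B : V → ℝ) (σ : V) : ℝ :=
  ∏ i ∈ Finset.range (G.dist o σ), edgeFactor G o K B ((parent G o)^[i] σ)

/-- `u` is the voltage function when a unit potential is imposed between the root and the
vertices at level at least `n`, in the network with conductance `C σ` along the edge that
precedes `σ`: it is `1` at the root, `0` at level at least `n`, and satisfies Kirchhoff's
node law (inflow equals outflow) at all other vertices. -/
structure IsUnitVoltage [G.LocallyFinite] (C : V → ℝ) (n : ℕ) (u : V → ℝ) : Prop where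
  root : u o = 1
  far : ∀ σ, n ≤ G.dist o σ → u σ = 0
  node : ∀ σ, σ ≠ o → G.dist o σ < n →
    C σ * (u (parent G o σ) - u σ) = ∑ τ ∈ successors G o σ, C τ * (u σ - u τ)

/-- The network with conductance `C σ` along the edge that precedes `σ` has conductance `c` from
the root to infinity: `c` is the limit, as `n → ∞`, of the total current that flows out of the
root when a unit potential is imposed between the root and level `n`. -/
def HasConductanceToInfinity [G.LocallyFinite] (C : V → ℝ) (c : ℝ) : Prop :=
  ∃ u : ℕ → V → ℝ, (∀ n, 0 < n → IsUnitVoltage G o C n (u n)) ∧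
    Tendsto (fun n => ∑ σ ∈ successors G o o, C σ * (u n o - u n σ)) atTop (𝓝 c)

end Network

end TreeRWRE

/-!
The proof combines a moment bound for the conductances, the energy of test functions, and a
comparison of superharmonic functions of the walk with voltages.

*Moments.* Let the minimum `p = E[A ^ x]` be attained at `x ∈ (0, 1]`. The factors of `C_σ` come
from the transition probabilities at distinct vertices, so they are independent and, up to the
finitely many exceptional factors, `E[C_σ ^ x]` is at most a constant times `p ^ |σ|`. By Fatou's
lemma the liminf of `∑ σ ∈ Π_n, C_σ ^ x` is a.s. finite
(`TreeRWRE.ae_frequently_sum_conductancePow_le`), and as `x ≤ 1`, so is the liminf of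
`∑ σ ∈ Π_n, C_σ`. The exceptional factors, among them those at level one, are finitely many positive
numbers in each environment, hence they do not matter
(`TreeRWRE.exists_frequently_sum_conductance_le`).

*Networks.* In a fixed environment there are thus `m` disjoint cutsets, for each `m`, each of
total conductance at most the same `M`. The function that drops by `1 / m` at each of them has energy
at most `M / m`, and it vanishes beyond some level by Kőnig's lemma. By Dirichlet's principle the
effective conductance to infinity is zero (`TreeRWRE.tendsto_downConductance_root`). Effective
conductances and voltages are given by the series and parallel laws, recursively in the distance
to the grounded level, so the voltage is explicit and the energy inequality is an induction
over levels.

*Recurrence.* A nonnegative superharmonic function dominates its value at the parent times the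
voltage of a branch. Since no branch has conductance to infinity, these voltages tend to `1`, so the
function does not decrease away from the root; being superharmonic, it is constant
(`TreeRWRE.eq_root_of_superharmonic`). The probability of ever reaching `v` is such a function and
equals `1` at `v`, so the walk started at `v` returns to `v`
(`TreeRWRE.isRecurrent_of_superharmonic_const`). This treats all starting vertices at once.
-/

/-! ### Parents, successors and levels of a rooted tree -/

namespace TreeRWRE

section Tree

variable {V : Type*} {G : SimpleGraph V} {o : V}

lemma exists_adj_dist_add_one (hG : G.IsTree) {σ : V} (hσ : σ ≠ o) :
    ∃ w, G.Adj σ w ∧ G.dist o w + 1 = G.dist o σ := by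
  obtain ⟨p, hp⟩ := hG.connected.exists_walk_length_eq_dist σ o
  cases p with
  | nil => exact absurd rfl hσ
  | @cons _ w _ h q =>
    refine ⟨w, h, ?_⟩
    rw [SimpleGraph.Walk.length_cons] at hp
    have h1 := SimpleGraph.dist_le q
    have h2 := hG.dist_eq_dist_add_one_of_adj o h
    rw [G.dist_comm (u := o) (v := w), G.dist_comm (u := o) (v := σ)] at *
    omega

lemma parent_spec (hG : G.IsTree) {σ : V} (hσ : σ ≠ o) :
    G.Adj σ (parent G o σ) ∧ G.dist o (parent G o σ) + 1 = G.dist o σ := by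
  have h := exists_adj_dist_add_one hG hσ
  rw [parent, dif_pos h]
  exact h.choose_spec

lemma eq_of_adj_of_dist_add_one (hG : G.IsTree) {σ w w' : V} (h : G.Adj σ w)
    (hd : G.dist o w + 1 = G.dist o σ) (h' : G.Adj σ w') (hd' : G.dist o w' + 1 = G.dist o σ) :
    w = w' := by
  obtain ⟨p, hp⟩ := hG.connected.exists_walk_length_eq_dist o w
  obtain ⟨q, hq⟩ := hG.connected.exists_walk_length_eq_dist o w'
  have hp1 : (p.concat h.symm).IsPath := SimpleGraph.Walk.isPath_of_length_eq_dist _ (by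
    rw [SimpleGraph.Walk.length_concat, hp, hd])
  have hq1 : (q.concat h'.symm).IsPath := SimpleGraph.Walk.isPath_of_length_eq_dist _ (by
    rw [SimpleGraph.Walk.length_concat, hq, hd'])
  have := (hG.existsUnique_path o σ).unique hp1 hq1
  exact (SimpleGraph.Walk.concat_inj this).1

lemma parent_eq (hG : G.IsTree) {σ w : V} (h : G.Adj σ w)
    (hd : G.dist o w + 1 = G.dist o σ) : parent G o σ = w := by
  have hσ : σ ≠ o := by rintro rfl; simp at hd
  exact eq_of_adj_of_dist_add_one hG (parent_spec hG hσ).1 (parent_spec hG hσ).2 h hd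

lemma dist_eq_zero_iff_eq_root (hG : G.IsTree) {σ : V} : G.dist o σ = 0 ↔ σ = o := by
  rw [hG.connected.dist_eq_zero_iff, eq_comm]

lemma dist_iterate_parent (hG : G.IsTree) (σ : V) :
    ∀ i ≤ G.dist o σ, G.dist o ((parent G o)^[i] σ) + i = G.dist o σ := by
  intro i
  induction i with
  | zero => intro _; rfl
  | succ i ih =>
    intro hi
    have h1 := ih (by omega)
    have hne : (parent G o)^[i] σ ≠ o := by
      intro h; rw [h, G.dist_self] at h1; omega
    have := (parent_spec hG hne).2
    rw [Function.iterate_succ_apply']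
    omega

lemma iterate_parent_dist (hG : G.IsTree) (σ : V) : (parent G o)^[G.dist o σ] σ = o := by
  have := dist_iterate_parent (o := o) hG σ _ le_rfl
  exact (dist_eq_zero_iff_eq_root hG).1 (by omega)

lemma iterate_parent_ne_root (hG : G.IsTree) {σ : V} {i : ℕ} (hi : i < G.dist o σ) :
    (parent G o)^[i] σ ≠ o := by
  intro h
  have := dist_iterate_parent (o := o) hG σ i hi.le
  rw [h, G.dist_self] at this
  omega

lemma iterate_parent_injOn (hG : G.IsTree) (σ : V) {i j : ℕ} (hi : i ≤ G.dist o σ)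
    (hj : j ≤ G.dist o σ) (h : (parent G o)^[i] σ = (parent G o)^[j] σ) : i = j := by
  have h1 := dist_iterate_parent hG σ i hi
  have h2 := dist_iterate_parent hG σ j hj
  rw [h] at h1; omega

variable [G.LocallyFinite]

lemma mem_successors {σ τ : V} :
    τ ∈ successors G o σ ↔ G.Adj σ τ ∧ G.dist o τ = G.dist o σ + 1 := by
  simp [successors]

lemma parent_of_mem_successors (hG : G.IsTree) {σ τ : V} (h : τ ∈ successors G o σ) :
    parent G o τ = σ := by
  rw [mem_successors] at h
  exact parent_eq hG h.1.symm h.2.symm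

lemma ne_root_of_mem_successors {σ τ : V} (h : τ ∈ successors G o σ) : τ ≠ o := by
  rintro rfl
  rw [mem_successors] at h
  simp at h

lemma mem_successors_parent (hG : G.IsTree) {τ : V} (h : τ ≠ o) :
    τ ∈ successors G o (parent G o τ) := by
  rw [mem_successors]
  exact ⟨(parent_spec hG h).1.symm, (parent_spec hG h).2.symm⟩

lemma parent_notMem_successors (hG : G.IsTree) {σ : V} (h : σ ≠ o) :
    parent G o σ ∉ successors G o σ := by
  rw [mem_successors]
  have := (parent_spec hG h).2
  omega

open Classical in
lemma neighborFinset_eq_insert (hG : G.IsTree) {σ : V} (h : σ ≠ o) :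
    G.neighborFinset σ = insert (parent G o σ) (successors G o σ) := by
  ext τ
  rw [Finset.mem_insert, mem_successors, SimpleGraph.mem_neighborFinset]
  constructor
  · intro hadj
    rcases hG.dist_eq_dist_add_one_of_adj o hadj with h1 | h1
    · exact Or.inl (parent_eq hG hadj h1.symm).symm
    · exact Or.inr ⟨hadj, h1⟩
  · rintro (rfl | h1)
    · exact (parent_spec hG h).1
    · exact h1.1

lemma neighborFinset_root : G.neighborFinset o = successors G o o := by
  ext τ
  rw [mem_successors, SimpleGraph.mem_neighborFinset]
  refine ⟨fun h => ⟨h, ?_⟩, fun h => h.1⟩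
  rw [G.dist_self, zero_add]
  exact SimpleGraph.dist_eq_one_iff_adj.2 h

variable (G o) in
open Classical in
/-- The finite set of vertices at distance `n` from the root. -/
noncomputable def level : ℕ → Finset V
  | 0 => {o}
  | n + 1 => (level n).biUnion (successors G o)

lemma mem_level (hG : G.IsTree) {n : ℕ} {σ : V} : σ ∈ level G o n ↔ G.dist o σ = n := by
  induction n generalizing σ with
  | zero => rw [level, Finset.mem_singleton, dist_eq_zero_iff_eq_root hG]
  | succ n ih =>
    classical
    rw [level, Finset.mem_biUnion]
    constructor
    · rintro ⟨τ, hτ, h⟩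
      rw [(mem_successors.1 h).2, ih.1 hτ]
    · intro h
      have hσ : σ ≠ o := by rintro rfl; simp at h
      refine ⟨parent G o σ, ih.2 ?_, mem_successors_parent hG hσ⟩
      have := (parent_spec hG hσ).2
      omega

lemma sum_level_succ (hG : G.IsTree) {M : Type*} [AddCommMonoid M] (n : ℕ) (F : V → M) :
    ∑ τ ∈ level G o (n + 1), F τ = ∑ σ ∈ level G o n, ∑ τ ∈ successors G o σ, F τ := by
  classical
  rw [level, Finset.sum_biUnion]
  intro σ _ σ' _ hne
  rw [Function.onFun, Finset.disjoint_left]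
  intro τ h h'
  exact hne ((parent_of_mem_successors hG h).symm.trans (parent_of_mem_successors hG h'))

/-- Kőnig's lemma for cutsets: below some level, every vertex has an ancestor in the cutset. -/
lemma IsCutset.exists_level (hG : G.IsTree) {S : Finset V} (hS : IsCutset G o S) :
    ∃ N, ∀ σ, N ≤ G.dist o σ → ∃ i, (parent G o)^[i] σ ∈ S := by
  by_contra! hcon
  -- `D σ`: arbitrarily far below `σ` there are vertices without an ancestor in the cutset
  let D : V → Prop := fun σ => ∀ N, ∃ τ, G.dist o τ = G.dist o σ + N ∧ (parent G o)^[N] τ = σ ∧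
    ∀ i, (parent G o)^[i] τ ∉ S
  have hroot : D o := by
    intro N
    obtain ⟨σ, hσ, hσS⟩ := hcon N
    have hd := dist_iterate_parent (o := o) hG σ (G.dist o σ - N) (by omega)
    have hd' : G.dist o ((parent G o)^[G.dist o σ - N] σ) = N := by omega
    refine ⟨(parent G o)^[G.dist o σ - N] σ, ?_, ?_, ?_⟩
    · rw [hd', G.dist_self, zero_add]
    · have := iterate_parent_dist (o := o) hG ((parent G o)^[G.dist o σ - N] σ)
      rwa [hd'] at this
    · intro i
      rw [← Function.iterate_add_apply]
      exact hσS _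
  have hstep : ∀ σ, D σ → ∃ τ ∈ successors G o σ, D τ := by
    intro σ hσ
    by_contra! hno
    have hno' : ∀ τ : V, ∃ N, τ ∈ successors G o σ → ∀ ρ, G.dist o ρ = G.dist o τ + N →
        (parent G o)^[N] ρ = τ → ∃ i, (parent G o)^[i] ρ ∈ S := by
      intro τ
      by_cases hτ : τ ∈ successors G o σ
      · have := hno τ hτ
        simp only [D] at this
        push Not at this
        obtain ⟨N, hN⟩ := this
        exact ⟨N, fun _ => hN⟩
      · exact ⟨0, fun h => absurd h hτ⟩
    choose N hN using hno'
    set M := (successors G o σ).sup N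
    obtain ⟨ρ, hρ, hρσ, hρS⟩ := hσ (M + 1)
    have hdM := dist_iterate_parent (o := o) hG ρ M (by omega)
    set τ := (parent G o)^[M] ρ with hτ
    have hτσ : parent G o τ = σ := by
      rw [← hρσ, Function.iterate_succ_apply']
    have hτo : τ ≠ o := by
      intro h; rw [h, G.dist_self] at hdM; omega
    have hmem : τ ∈ successors G o σ := by
      have := mem_successors_parent hG hτo
      rwa [hτσ] at this
    have hle : N τ ≤ M := Finset.le_sup hmem
    have hd2 := dist_iterate_parent (o := o) hG ρ (M - N τ) (by omega)
    have hadd : N τ + (M - N τ) = M := by omega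
    obtain ⟨i, hi⟩ := hN τ hmem ((parent G o)^[M - N τ] ρ) (by omega) (by
      rw [← Function.iterate_add_apply, hadd])
    rw [← Function.iterate_add_apply] at hi
    exact hρS _ hi
  choose! next hnext using hstep
  let r : ℕ → V := fun n => next^[n] o
  have hr : ∀ n, D (r n) := by
    intro n
    induction n with
    | zero => exact hroot
    | succ n ih =>
      change D (next^[n + 1] o)
      rw [Function.iterate_succ_apply']
      exact (hnext _ ih).2
  have hrs : ∀ n, r (n + 1) ∈ successors G o (r n) := by
    intro n
    change next^[n + 1] o ∈ _
    rw [Function.iterate_succ_apply']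
    exact (hnext _ (hr n)).1
  have hd : ∀ n, G.dist o (r n) = n := by
    intro n
    induction n with
    | zero => exact G.dist_self
    | succ n ih => rw [(mem_successors.1 (hrs n)).2, ih]
  obtain ⟨n, hn⟩ := hS.meets r rfl (fun n => (mem_successors.1 (hrs n)).1)
    (fun m n h => by rw [← hd m, ← hd n, h])
  obtain ⟨τ, -, h2, h3⟩ := hr n 0
  refine h3 0 ?_
  rw [h2]
  exact hn

end Tree

/-! ### Effective conductances on a tree -/


section Network

variable {V : Type*} (G : SimpleGraph V) (o : V) [G.LocallyFinite]

/-- The effective conductance between the parent of `τ` and the vertices `k` levels below `τ`,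
through the branch at `τ`, in the network with conductance `C σ` along the edge that precedes `σ`:
the edge that precedes `τ` is in series with the branches at the successors of `τ`, which are in
parallel. -/
noncomputable def branchConductance (C : V → ℝ) : ℕ → V → ℝ
  | 0, τ => C τ
  | k + 1, τ => C τ * (∑ ρ ∈ successors G o τ, branchConductance C k ρ) /
      (C τ + ∑ ρ ∈ successors G o τ, branchConductance C k ρ)

/-- The effective conductance between `σ` and the vertices `k + 1` levels below it. -/
noncomputable def downConductance (C : V → ℝ) (k : ℕ) (σ : V) : ℝ :=
  ∑ τ ∈ successors G o σ, branchConductance G o C k τ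

variable {G o}

lemma branchConductance_succ (C : V → ℝ) (k : ℕ) (τ : V) :
    branchConductance G o C (k + 1) τ =
      C τ * downConductance G o C k τ / (C τ + downConductance G o C k τ) := rfl

lemma branchConductance_nonneg {C : V → ℝ} (hC : ∀ σ, σ ≠ o → 0 < C σ) (k : ℕ) {τ : V}
    (hτ : τ ≠ o) : 0 ≤ branchConductance G o C k τ := by
  induction k generalizing τ with
  | zero => exact (hC τ hτ).le
  | succ k ih =>
    have h : 0 ≤ downConductance G o C k τ :=
      Finset.sum_nonneg fun ρ hρ => ih (ne_root_of_mem_successors hρ)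
    have := (hC τ hτ).le
    rw [branchConductance_succ]
    positivity

lemma downConductance_nonneg {C : V → ℝ} (hC : ∀ σ, σ ≠ o → 0 < C σ) (k : ℕ) (σ : V) :
    0 ≤ downConductance G o C k σ :=
  Finset.sum_nonneg fun _ hρ => branchConductance_nonneg hC k (ne_root_of_mem_successors hρ)

/-- Two conductances in series dissipate the least energy. -/
lemma series_energy_le {c s a b : ℝ} (hc : 0 < c) (hs : 0 ≤ s) :
    c * s / (c + s) * a ^ 2 ≤ c * (a - b) ^ 2 + s * b ^ 2 := by
  rw [div_mul_eq_mul_div, div_le_iff₀ (by positivity)]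
  nlinarith [sq_nonneg (c * (a - b) - s * b)]

/-- The energy of a function `f` that vanishes at levels at least `n` is bounded below by the
effective conductance. This is a half of Dirichlet's principle. -/
lemma downConductance_mul_sq_le (hG : G.IsTree) {C : V → ℝ} (hC : ∀ σ, σ ≠ o → 0 < C σ) {n : ℕ}
    {f : V → ℝ} (hf : ∀ σ, n + 1 ≤ G.dist o σ → f σ = 0) :
    downConductance G o C n o * f o ^ 2 ≤
      ∑ i ∈ Finset.range (n + 1), ∑ σ ∈ level G o (i + 1),
        C σ * (f (parent G o σ) - f σ) ^ 2 := by
  -- descend one level at a time, replacing the unexplored part by its effective conductance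
  have key : ∀ j k, j + k = n → downConductance G o C n o * f o ^ 2 ≤
      ∑ i ∈ Finset.range j, ∑ σ ∈ level G o (i + 1), C σ * (f (parent G o σ) - f σ) ^ 2 +
      ∑ σ ∈ level G o j, downConductance G o C k σ * f σ ^ 2 := by
    intro j
    induction j with
    | zero =>
      intro k hk
      obtain rfl : k = n := by omega
      simp [level]
    | succ j ih =>
      intro k hk
      refine (ih (k + 1) (by omega)).trans ?_
      rw [Finset.sum_range_succ, add_assoc]
      gcongr
      rw [← Finset.sum_add_distrib, sum_level_succ hG]
      refine Finset.sum_le_sum fun σ _ => ?_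
      rw [downConductance, Finset.sum_mul]
      refine Finset.sum_le_sum fun τ hτ => ?_
      rw [parent_of_mem_successors hG hτ, branchConductance_succ]
      exact series_energy_le (hC τ (ne_root_of_mem_successors hτ)) (downConductance_nonneg hC _ _)
  refine (key n 0 rfl).trans_eq ?_
  rw [Finset.sum_range_succ, sum_level_succ hG n]
  congr 1
  refine Finset.sum_congr rfl fun σ hσ => ?_
  rw [downConductance, Finset.sum_mul]
  refine Finset.sum_congr rfl fun τ hτ => ?_
  have h0 : f τ = 0 := hf τ (by rw [(mem_successors.1 hτ).2, (mem_level hG).1 hσ])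
  rw [parent_of_mem_successors hG hτ, h0, sub_zero, branchConductance]

/-- If the function `f` in Dirichlet's principle is constant along all edges but those that precede
the vertices of a finite set `T`, only these edges contribute to the energy. -/
lemma downConductance_mul_sq_le_sum (hG : G.IsTree) {C : V → ℝ} (hC : ∀ σ, σ ≠ o → 0 < C σ) {n : ℕ}
    {f : V → ℝ} (hf : ∀ σ, n + 1 ≤ G.dist o σ → f σ = 0) {T : Finset V} (ho : o ∉ T)
    (hT : ∀ σ, σ ≠ o → σ ∉ T → f (parent G o σ) = f σ) :
    downConductance G o C n o * f o ^ 2 ≤ ∑ σ ∈ T, C σ * (f (parent G o σ) - f σ) ^ 2 := by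
  classical
  refine (downConductance_mul_sq_le hG hC hf).trans ?_
  have hlev : ∀ i, ∑ σ ∈ level G o (i + 1), C σ * (f (parent G o σ) - f σ) ^ 2 =
      ∑ σ ∈ T with G.dist o σ = i + 1, C σ * (f (parent G o σ) - f σ) ^ 2 := by
    intro i
    symm
    refine Finset.sum_subset (fun σ hσ => (mem_level hG).2 (Finset.mem_filter.1 hσ).2) ?_
    intro σ hσ hσT
    rw [mem_level hG] at hσ
    have hne : σ ≠ o := by rintro rfl; simp at hσ
    rw [hT σ hne fun h => hσT (Finset.mem_filter.2 ⟨h, hσ⟩), sub_self]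
    ring
  simp_rw [hlev]
  rw [← Finset.sum_biUnion]
  · refine Finset.sum_le_sum_of_subset_of_nonneg
      (Finset.biUnion_subset.2 fun i _ => Finset.filter_subset _ _) fun σ hσ _ => ?_
    exact mul_nonneg (hC σ fun h => ho (h ▸ hσ)).le (sq_nonneg _)
  · intro i _ j _ hij
    rw [Function.onFun, Finset.disjoint_left]
    intro σ h h'
    have h1 := (Finset.mem_filter.1 h).2
    have h2 := (Finset.mem_filter.1 h').2
    omega

/-- Test functions for the Nash-Williams criterion. Going from the root to infinity, `f` drops from
`m` to `0`, by one at each of `m` disjoint cutsets of bounded total conductance. -/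
lemma exists_test_function (hG : G.IsTree) {C : V → ℝ} (hC : ∀ σ, σ ≠ o → 0 < C σ) {M : ℝ}
    {S : ℕ → Finset V} (hcut : ∀ n, IsCutset G o (S n))
    (hfar : ∀ m : ℕ, ∀ᶠ n in atTop, ∀ σ ∈ S n, m ≤ G.dist o σ)
    (hM : ∃ᶠ n in atTop, ∑ σ ∈ S n, C σ ≤ M) (m : ℕ) :
    ∃ (f : V → ℝ) (T : Finset V) (N : ℕ), f o = m ∧ o ∉ T ∧ (∀ σ, N ≤ G.dist o σ → f σ = 0) ∧
      (∀ σ, σ ≠ o → σ ∉ T → f (parent G o σ) = f σ) ∧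
      ∑ σ ∈ T, C σ * (f (parent G o σ) - f σ) ^ 2 ≤ m * M := by
  classical
  induction m with
  | zero => exact ⟨0, ∅, 0, by simp⟩
  | succ m ih =>
    obtain ⟨f, T, N, hfo, hoT, hfN, hfT, hE⟩ := ih
    obtain ⟨n, hnM, hn⟩ := (hM.and_eventually (hfar (T.sup (G.dist o) + 1))).exists
    obtain ⟨N', hN'⟩ := (hcut n).exists_level hG
    have hoS := (hcut n).root_notMem
    have hdisj : Disjoint T (S n) := Finset.disjoint_left.2 fun σ hσ hσS => by
      have h1 := hn σ hσS
      have h2 : G.dist o σ ≤ T.sup (G.dist o) := Finset.le_sup (f := G.dist o) hσ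
      omega
    let A : V → Prop := fun σ => ∃ i, (parent G o)^[i] σ ∈ S n
    let g : V → ℝ := fun σ => if A σ then 0 else 1
    have hAparent : ∀ σ, A (parent G o σ) → A σ := by
      rintro σ ⟨i, hi⟩
      exact ⟨i + 1, by rwa [Function.iterate_succ_apply]⟩
    have hgS : ∀ σ, σ ∉ S n → g (parent G o σ) = g σ := by
      intro σ hσ
      have : A (parent G o σ) ↔ A σ := by
        refine ⟨hAparent σ, ?_⟩
        rintro ⟨i, hi⟩
        cases i with
        | zero => exact absurd hi hσ
        | succ i => exact ⟨i, by rwa [Function.iterate_succ_apply] at hi⟩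
      simp only [g, this]
    have hgsq : ∀ σ, (g (parent G o σ) - g σ) ^ 2 ≤ 1 := by
      intro σ
      simp only [g]
      split_ifs <;> norm_num
    have hgo : g o = 1 := by
      have : ¬ A o := by
        rintro ⟨i, hi⟩
        have hpo : parent G o o = o := by
          rw [parent, dif_neg]
          rintro ⟨w, -, hw⟩
          simp at hw
        rw [Function.iterate_fixed hpo] at hi
        exact hoS hi
      simp only [g, this, if_false]
    refine ⟨f + g, T ∪ S n, max N N', ?_, ?_, ?_, ?_, ?_⟩
    · simp [hfo, hgo]
    · simp [hoT, hoS]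
    · intro σ hσ
      have : A σ := hN' σ (le_of_max_le_right hσ)
      simp [hfN σ (le_of_max_le_left hσ), g, this]
    · intro σ hσo hσ
      rw [Finset.mem_union, not_or] at hσ
      simp [hfT σ hσo hσ.1, hgS σ hσ.2]
    · rw [Finset.sum_union hdisj]
      push_cast
      rw [add_mul, one_mul]
      refine add_le_add (le_trans (Finset.sum_le_sum fun σ hσ => ?_) hE)
        (le_trans (Finset.sum_le_sum fun σ hσ => ?_) hnM)
      · rw [Pi.add_apply, Pi.add_apply, hgS σ (Finset.disjoint_left.1 hdisj hσ),
          add_sub_add_right_eq_sub]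
      · have hσo : σ ≠ o := fun h => hoS (h ▸ hσ)
        rw [Pi.add_apply, Pi.add_apply, hfT σ hσo (Finset.disjoint_right.1 hdisj hσ),
          add_sub_add_left_eq_sub]
        exact mul_le_of_le_one_right (hC σ hσo).le (hgsq σ)

/-- A form of the Nash-Williams criterion: the effective conductance from the root to level `n`
tends to zero if there are arbitrarily distant cutsets of bounded total conductance. -/
theorem tendsto_downConductance_root (hG : G.IsTree) {C : V → ℝ} (hC : ∀ σ, σ ≠ o → 0 < C σ)
    {M : ℝ} {S : ℕ → Finset V} (hcut : ∀ n, IsCutset G o (S n))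
    (hfar : ∀ m : ℕ, ∀ᶠ n in atTop, ∀ σ ∈ S n, m ≤ G.dist o σ)
    (hM : ∃ᶠ n in atTop, ∑ σ ∈ S n, C σ ≤ M) :
    Tendsto (fun n => downConductance G o C n o) atTop (𝓝 0) := by
  have hlim : Tendsto (fun m : ℕ => M / ((m : ℝ) + 1)) atTop (𝓝 0) :=
    tendsto_const_nhds.div_atTop
      (tendsto_atTop_add_const_right _ _ tendsto_natCast_atTop_atTop)
  rw [tendsto_order]
  refine ⟨fun a ha => Eventually.of_forall fun n => ha.trans_le (downConductance_nonneg hC n o),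
    fun a ha => ?_⟩
  obtain ⟨m, hm⟩ := (hlim.eventually_lt_const ha).exists
  obtain ⟨f, T, N, hfo, hoT, hfN, hfT, hE⟩ := exists_test_function hG hC hcut hfar hM (m + 1)
  filter_upwards [eventually_ge_atTop N] with n hn
  have h := (downConductance_mul_sq_le_sum hG hC (n := n) (fun σ hσ => hfN σ (by omega)) hoT
    hfT).trans hE
  rw [hfo] at h
  push_cast at h
  refine lt_of_le_of_lt ?_ hm
  rw [le_div_iff₀ (by positivity)]
  have hpos : (0 : ℝ) < m + 1 := by positivity
  refine le_of_mul_le_mul_right ?_ hpos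
  linarith [h]

/-- In a network without conductance to infinity, no branch has conductance to infinity. -/
lemma tendsto_downConductance (hG : G.IsTree) {C : V → ℝ} (hC : ∀ σ, σ ≠ o → 0 < C σ)
    (h : Tendsto (fun n => downConductance G o C n o) atTop (𝓝 0)) (σ : V) :
    Tendsto (fun n => downConductance G o C n σ) atTop (𝓝 0) := by
  obtain ⟨n, hn⟩ : ∃ n, G.dist o σ = n := ⟨_, rfl⟩
  induction n generalizing σ with
  | zero => rwa [(dist_eq_zero_iff_eq_root hG).1 hn]
  | succ n ih =>
    have hσ : σ ≠ o := by rintro rfl; simp at hn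
    have hp := (parent_spec hG hσ).2
    have hpar := ih (parent G o σ) (by omega)
    have hbr : Tendsto (fun n => branchConductance G o C n σ) atTop (𝓝 0) :=
      squeeze_zero (fun n => branchConductance_nonneg hC n hσ) (fun n =>
        Finset.single_le_sum (f := fun τ => branchConductance G o C n τ)
          (fun τ hτ => branchConductance_nonneg hC n (ne_root_of_mem_successors hτ))
          (mem_successors_parent hG hσ)) hpar
    -- the formula for conductances in series, solved for the conductance below `σ`
    have hs : ∀ n, downConductance G o C n σ = C σ * branchConductance G o C (n + 1) σ /
        (C σ - branchConductance G o C (n + 1) σ) := by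
      intro n
      have h1 := hC σ hσ
      have h2 := downConductance_nonneg (G := G) hC n σ
      have h3 : 0 < C σ + downConductance G o C n σ := by positivity
      have h4 : C σ - branchConductance G o C (n + 1) σ =
          C σ ^ 2 / (C σ + downConductance G o C n σ) := by
        rw [branchConductance_succ]; field_simp; ring
      rw [h4, branchConductance_succ]
      field_simp
    simp_rw [hs]
    have hbr' := (tendsto_add_atTop_iff_nat 1).2 hbr
    have := (hbr'.const_mul (C σ)).div (hbr'.const_sub (C σ)) (by
      simpa using (hC σ hσ).ne')
    simpa [Pi.div_def] using this

/-! ### Voltages -/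

variable (G o) in
/-- The potential at `σ` when a unit potential is imposed between the root and level `n`; at a
vertex above level `n` it is the potential at the parent, divided between the edge that precedes
the vertex and the branches below. -/
noncomputable def voltage (C : V → ℝ) (n : ℕ) (σ : V) : ℝ :=
  ∏ i ∈ Finset.range (G.dist o σ),
    (if G.dist o ((parent G o)^[i] σ) < n then
      C ((parent G o)^[i] σ) / (C ((parent G o)^[i] σ) +
        downConductance G o C (n - G.dist o ((parent G o)^[i] σ) - 1) ((parent G o)^[i] σ))
    else 0)

lemma voltage_root (C : V → ℝ) (n : ℕ) : voltage G o C n o = 1 := by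
  simp [voltage]

lemma voltage_eq (hG : G.IsTree) (C : V → ℝ) (n : ℕ) {σ : V} (hσ : σ ≠ o) :
    voltage G o C n σ = (if G.dist o σ < n then
      C σ / (C σ + downConductance G o C (n - G.dist o σ - 1) σ) else 0) *
        voltage G o C n (parent G o σ) := by
  have h := (parent_spec hG hσ).2
  rw [voltage, ← h, Finset.prod_range_succ', mul_comm, h]
  rfl

lemma voltage_of_le_dist (hG : G.IsTree) (C : V → ℝ) {n : ℕ} (hn : 0 < n) {σ : V}
    (hσ : n ≤ G.dist o σ) : voltage G o C n σ = 0 := by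
  have hne : σ ≠ o := by rintro rfl; simp at hσ; omega
  rw [voltage_eq hG C n hne, if_neg (by omega), zero_mul]

/-- The current through the edge that precedes `τ`. -/
lemma mul_voltage_sub (hG : G.IsTree) {C : V → ℝ} (hC : ∀ σ, σ ≠ o → 0 < C σ) {n : ℕ} {σ τ : V}
    (hσ : G.dist o σ < n) (hτ : τ ∈ successors G o σ) :
    C τ * (voltage G o C n σ - voltage G o C n τ) =
      voltage G o C n σ * branchConductance G o C (n - G.dist o σ - 1) τ := by
  have hτo := ne_root_of_mem_successors hτ
  have hd := (mem_successors.1 hτ).2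
  rw [voltage_eq hG C n hτo, parent_of_mem_successors hG hτ, hd]
  split_ifs with h
  · obtain ⟨k, hk⟩ : ∃ k, n - G.dist o σ - 1 = k + 1 := ⟨n - G.dist o σ - 2, by omega⟩
    rw [hk, branchConductance_succ, show n - (G.dist o σ + 1) - 1 = k by omega]
    have h1 := hC τ hτo
    have h2 := downConductance_nonneg (G := G) hC k τ
    have h3 : 0 < C τ + downConductance G o C k τ := by positivity
    field_simp
    ring
  · rw [show n - G.dist o σ - 1 = 0 by omega, branchConductance]
    ring

lemma sum_mul_voltage_sub (hG : G.IsTree) {C : V → ℝ} (hC : ∀ σ, σ ≠ o → 0 < C σ) {n : ℕ} {σ : V}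
    (hσ : G.dist o σ < n) :
    ∑ τ ∈ successors G o σ, C τ * (voltage G o C n σ - voltage G o C n τ) =
      voltage G o C n σ * downConductance G o C (n - G.dist o σ - 1) σ := by
  rw [downConductance, Finset.mul_sum]
  exact Finset.sum_congr rfl fun τ hτ => mul_voltage_sub hG hC hσ hτ

lemma isUnitVoltage_voltage (hG : G.IsTree) {C : V → ℝ} (hC : ∀ σ, σ ≠ o → 0 < C σ) {n : ℕ}
    (hn : 0 < n) : IsUnitVoltage G o C n (voltage G o C n) where
  root := voltage_root C n
  far _ hσ := voltage_of_le_dist hG C hn hσ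
  node σ hσ hd := by
    rw [sum_mul_voltage_sub hG hC hd, voltage_eq hG C n hσ, if_pos hd]
    have h1 := hC σ hσ
    have h2 := downConductance_nonneg (G := G) hC (n - G.dist o σ - 1) σ
    have h3 : 0 < C σ + downConductance G o C (n - G.dist o σ - 1) σ := by positivity
    field_simp
    ring

theorem hasConductanceToInfinity_zero (hG : G.IsTree) {C : V → ℝ} (hC : ∀ σ, σ ≠ o → 0 < C σ)
    (h : Tendsto (fun n => downConductance G o C n o) atTop (𝓝 0)) :
    HasConductanceToInfinity G o C 0 := by
  refine ⟨voltage G o C, fun n hn => isUnitVoltage_voltage hG hC hn, ?_⟩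
  rw [← tendsto_add_atTop_iff_nat 1]
  refine h.congr fun n => ?_
  rw [sum_mul_voltage_sub hG hC (by simp), voltage_root, G.dist_self, one_mul]
  rfl

end Network

/-! ### Superharmonic functions -/


section Superharmonic

variable {V : Type*} {G : SimpleGraph V} {o : V} [G.LocallyFinite]

/-- If `f` is nonnegative and superharmonic, then `f σ` is at least the voltage at `σ` when the
potential `f (parent σ)` is imposed at the parent of `σ` and `0` is imposed `k + 1` levels
below `σ`. -/
lemma mul_parent_le_of_superharmonic (hG : G.IsTree) {C : V → ℝ} (hC : ∀ σ, σ ≠ o → 0 < C σ)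
    {f : V → ℝ} (hf0 : ∀ σ, 0 ≤ f σ)
    (hf : ∀ σ, σ ≠ o → C σ * f (parent G o σ) + ∑ τ ∈ successors G o σ, C τ * f τ ≤
      (C σ + ∑ τ ∈ successors G o σ, C τ) * f σ) (k : ℕ) {σ : V} (hσ : σ ≠ o) :
    C σ * f (parent G o σ) ≤ (C σ + downConductance G o C k σ) * f σ := by
  induction k generalizing σ with
  | zero =>
    have h1 : 0 ≤ ∑ τ ∈ successors G o σ, C τ * f τ := Finset.sum_nonneg fun τ hτ =>
      mul_nonneg (hC τ (ne_root_of_mem_successors hτ)).le (hf0 τ)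
    have h2 := hf σ hσ
    simp only [downConductance, branchConductance]
    linarith
  | succ k ih =>
    have h1 : ∑ τ ∈ successors G o σ, (C τ - branchConductance G o C (k + 1) τ) * f σ ≤
        ∑ τ ∈ successors G o σ, C τ * f τ := by
      refine Finset.sum_le_sum fun τ hτ => ?_
      have hτo := ne_root_of_mem_successors hτ
      have h2 := ih hτo
      rw [parent_of_mem_successors hG hτ] at h2
      have h3 := hC τ hτo
      have h4 := downConductance_nonneg (G := G) hC k τ
      have h5 : C τ - branchConductance G o C (k + 1) τ =
          C τ * (C τ / (C τ + downConductance G o C k τ)) := by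
        have h6 : 0 < C τ + downConductance G o C k τ := by positivity
        rw [branchConductance_succ]; field_simp; ring
      rw [h5, mul_assoc]
      refine mul_le_mul_of_nonneg_left ?_ h3.le
      rw [div_mul_eq_mul_div, div_le_iff₀ (by positivity)]
      linarith
    rw [← Finset.sum_mul, Finset.sum_sub_distrib] at h1
    have h2 := hf σ hσ
    rw [downConductance]
    linarith

lemma parent_le_of_superharmonic (hG : G.IsTree) {C : V → ℝ} (hC : ∀ σ, σ ≠ o → 0 < C σ)
    (h : Tendsto (fun n => downConductance G o C n o) atTop (𝓝 0))
    {f : V → ℝ} (hf0 : ∀ σ, 0 ≤ f σ)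
    (hf : ∀ σ, σ ≠ o → C σ * f (parent G o σ) + ∑ τ ∈ successors G o σ, C τ * f τ ≤
      (C σ + ∑ τ ∈ successors G o σ, C τ) * f σ) {σ : V} (hσ : σ ≠ o) :
    f (parent G o σ) ≤ f σ := by
  have h1 := ((tendsto_downConductance hG hC h σ).const_add (C σ)).mul_const (f σ)
  have h2 := ge_of_tendsto' h1 fun k => mul_parent_le_of_superharmonic hG hC hf0 hf k hσ
  rw [add_zero] at h2
  exact le_of_mul_le_mul_left h2 (hC σ hσ)

lemma eq_of_weighted_sum_le {ι : Type*} {s : Finset ι} {w f : ι → ℝ} {a : ℝ}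
    (hw : ∀ i ∈ s, 0 < w i) (hf : ∀ i ∈ s, a ≤ f i)
    (h : ∑ i ∈ s, w i * f i ≤ (∑ i ∈ s, w i) * a) : ∀ i ∈ s, f i = a := by
  have h0 : ∑ i ∈ s, w i * (f i - a) = 0 := by
    refine le_antisymm ?_ (Finset.sum_nonneg fun i hi =>
      mul_nonneg (hw i hi).le (sub_nonneg.2 (hf i hi)))
    simp_rw [mul_sub, Finset.sum_sub_distrib, ← Finset.sum_mul]
    linarith
  rw [Finset.sum_eq_zero_iff_of_nonneg fun i hi =>
    mul_nonneg (hw i hi).le (sub_nonneg.2 (hf i hi))] at h0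
  intro i hi
  rcases mul_eq_zero.1 (h0 i hi) with h | h
  · exact absurd h (hw i hi).ne'
  · linarith

/-- In a network without conductance to infinity, nonnegative superharmonic functions of the
associated Markov chain are constant. -/
theorem eq_root_of_superharmonic (hG : G.IsTree) {C : V → ℝ} (hC : ∀ σ, σ ≠ o → 0 < C σ)
    (h : Tendsto (fun n => downConductance G o C n o) atTop (𝓝 0))
    {k : V → V → ℝ} (hk : ∀ σ τ, G.Adj σ τ → 0 < k σ τ)
    (hk1 : ∀ σ, ∑ τ ∈ G.neighborFinset σ, k σ τ = 1)
    (hkC : ∀ σ, σ ≠ o → ∀ τ ∈ successors G o σ, C τ * k σ (parent G o σ) = C σ * k σ τ)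
    {f : V → ℝ} (hf0 : ∀ σ, 0 ≤ f σ) (hf : ∀ σ, ∑ τ ∈ G.neighborFinset σ, k σ τ * f τ ≤ f σ)
    (σ : V) : f σ = f o := by
  classical
  have hfC : ∀ σ, σ ≠ o → C σ * f (parent G o σ) + ∑ τ ∈ successors G o σ, C τ * f τ ≤
      (C σ + ∑ τ ∈ successors G o σ, C τ) * f σ := by
    intro σ hσ
    have hp := hk σ _ (parent_spec hG hσ).1
    have hmul : ∀ g : V → ℝ, k σ (parent G o σ) *
        (C σ * g (parent G o σ) + ∑ τ ∈ successors G o σ, C τ * g τ) =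
        C σ * ∑ τ ∈ G.neighborFinset σ, k σ τ * g τ := by
      intro g
      rw [neighborFinset_eq_insert hG hσ, Finset.sum_insert (parent_notMem_successors hG hσ),
        mul_add, mul_add, Finset.mul_sum, Finset.mul_sum]
      congr 1
      · ring
      · refine Finset.sum_congr rfl fun τ hτ => ?_
        rw [← mul_assoc, ← mul_assoc, ← hkC σ hσ τ hτ, mul_comm (k σ _)]
    have h1 := hmul f
    have h2 := hmul 1
    simp only [Pi.one_apply, mul_one, hk1] at h2
    refine le_of_mul_le_mul_left ?_ hp
    rw [h1, ← mul_assoc, h2]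
    exact mul_le_mul_of_nonneg_left (hf σ) (hC σ hσ).le
  have hle : ∀ σ, ∀ τ ∈ successors G o σ, f σ ≤ f τ := by
    intro σ τ hτ
    have := parent_le_of_superharmonic hG hC h hf0 hfC (ne_root_of_mem_successors hτ)
    rwa [parent_of_mem_successors hG hτ] at this
  obtain ⟨n, hn⟩ : ∃ n, G.dist o σ = n := ⟨_, rfl⟩
  suffices hs : ∀ n, ∀ σ, G.dist o σ = n → ∀ τ ∈ successors G o σ, f τ = f σ by
    induction n generalizing σ with
    | zero => rw [(dist_eq_zero_iff_eq_root hG).1 hn]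
    | succ n ih =>
      have hσ : σ ≠ o := by rintro rfl; simp at hn
      have hp := (parent_spec hG hσ).2
      rw [hs n (parent G o σ) (by omega) σ (mem_successors_parent hG hσ)]
      exact ih _ (by omega)
  intro n σ hn
  induction n generalizing σ with
  | zero =>
    obtain rfl := (dist_eq_zero_iff_eq_root hG).1 hn
    refine eq_of_weighted_sum_le (w := k σ) (fun τ hτ => hk _ _ (mem_successors.1 hτ).1)
      (hle _) ?_
    rw [← neighborFinset_root, hk1, one_mul]
    exact hf σ
  | succ n ih =>
    have hσ : σ ≠ o := by rintro rfl; simp at hn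
    have hp := (parent_spec hG hσ).2
    refine eq_of_weighted_sum_le (w := C) (fun τ hτ => hC _ (ne_root_of_mem_successors hτ))
      (hle _) ?_
    have h1 := hfC σ hσ
    rw [← ih (parent G o σ) (by omega) σ (mem_successors_parent hG hσ)] at h1
    linarith

end Superharmonic

/-! ### Avoidance probabilities of a Markov chain -/

section Walk

variable {V : Type*}

lemma lintegral_toMeasure [MeasurableSpace V] [DiscreteMeasurableSpace V] (p : PMF V)
    (f : V → ℝ≥0∞) : ∫⁻ y, f y ∂p.toMeasure = ∑' y, p y * f y := by
  rw [← PMF.restrict_toMeasure_support, lintegral_countable _ p.support_countable]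
  simp_rw [PMF.toMeasure_apply_singleton _ _ (MeasurableSet.of_discrete), mul_comm (f _)]
  rw [tsum_subtype p.support fun y => p y * f y]
  refine tsum_congr fun y => ?_
  by_cases hy : y ∈ p.support
  · rw [Set.indicator_of_mem hy]
  · rw [Set.indicator_of_notMem hy, (PMF.apply_eq_zero_iff _ _).2 hy, zero_mul]

/-- The Markov property at time `j`, for functions of the past and of the next state. -/
lemma lintegral_walkLaw_succ [MeasurableSpace V] [DiscreteMeasurableSpace V] (K : V → PMF V) (v : V)
    (j : ℕ) {g : (Finset.Iic j → V) → ℝ≥0∞} (hg : Measurable g) (h : V → ℝ≥0∞) :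
    ∫⁻ X, g (Preorder.frestrictLe j X) * h (X (j + 1)) ∂walkLaw K v =
      ∫⁻ X, g (Preorder.frestrictLe j X) * ∑' y, K (X j) y * h y ∂walkLaw K v := by
  have hh : Measurable h := Measurable.of_discrete
  have hh' : Measurable fun x => ∑' y, K x y * h y := Measurable.of_discrete
  have hmap := Kernel.partialTraj_compProd_eq_map_traj (κ := historyKernel K)
    (X := fun _ => V) (Nat.zero_le j) (x₀ := fun _ => v)
  have hg' : Measurable fun z : Finset.Iic j → V =>
      g z * ∑' y, K (z ⟨j, Finset.mem_Iic.2 le_rfl⟩) y * h y :=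
    hg.mul (hh'.comp (measurable_pi_apply _))
  have h1 : ∫⁻ X, g (Preorder.frestrictLe j X) * h (X (j + 1)) ∂walkLaw K v =
      ∫⁻ z, g z.1 * h z.2
        ∂((walkLaw K v).map fun X => (Preorder.frestrictLe j X, X (j + 1))) := by
    rw [lintegral_map (by fun_prop) (by fun_prop)]
  have h2 : ∫⁻ X, g (Preorder.frestrictLe j X) * ∑' y, K (X j) y * h y ∂walkLaw K v =
      ∫⁻ z, g z * ∑' y, K (z ⟨j, Finset.mem_Iic.2 le_rfl⟩) y * h y
        ∂((walkLaw K v).map (Preorder.frestrictLe j)) := by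
    rw [lintegral_map hg' (by fun_prop)]
    rfl
  rw [h1, h2]
  unfold walkLaw
  rw [← hmap, Measure.lintegral_compProd (by fun_prop), Kernel.traj_map_frestrictLe_apply]
  refine lintegral_congr fun z => ?_
  dsimp only
  rw [lintegral_const_mul _ (by fun_prop), historyKernel, Kernel.comap_apply]
  congr 1
  exact lintegral_toMeasure _ _

lemma lintegral_walkLaw_zero [MeasurableSpace V] [DiscreteMeasurableSpace V] (K : V → PMF V) (v : V)
    (h : V → ℝ≥0∞) : ∫⁻ X, h (X 0) ∂walkLaw K v = h v := by
  have hh : Measurable fun z : Finset.Iic 0 → V => h (z ⟨0, Finset.mem_Iic.2 le_rfl⟩) :=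
    Measurable.of_discrete.comp (measurable_pi_apply _)
  have h1 : ∫⁻ X, h (X 0) ∂walkLaw K v =
      ∫⁻ z, h (z ⟨0, Finset.mem_Iic.2 le_rfl⟩) ∂((walkLaw K v).map (Preorder.frestrictLe 0)) := by
    rw [lintegral_map hh (by fun_prop)]
    rfl
  rw [h1, walkLaw, Kernel.traj_map_frestrictLe_apply, Kernel.partialTraj_self, Kernel.id_apply,
    lintegral_dirac' _ hh]

open Classical in
/-- The probability that the Markov chain started at `x` avoids `v` at the times `1, …, N`. -/
noncomputable def avoidProb (K : V → PMF V) (v : V) : ℕ → V → ℝ≥0∞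
  | 0, _ => 1
  | N + 1, x => ∑' y, K x y * if y = v then 0 else avoidProb K v N y

lemma walkLaw_avoid [MeasurableSpace V] [DiscreteMeasurableSpace V] (K : V → PMF V) (v x : V)
    (N : ℕ) : walkLaw K x {X | ∀ n, 0 < n → n ≤ N → X n ≠ v} = avoidProb K v N x := by
  classical
  have key : ∀ j k, ∫⁻ X, {X : ℕ → V | ∀ n, 0 < n → n ≤ j → X n ≠ v}.indicator 1 X *
      avoidProb K v k (X j) ∂walkLaw K x = avoidProb K v (j + k) x := by
    intro j
    induction j with
    | zero =>
      intro k
      have : {X : ℕ → V | ∀ n, 0 < n → n ≤ 0 → X n ≠ v} = Set.univ := by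
        ext X
        simp only [Set.mem_ofPred_eq, Set.mem_univ, iff_true]
        intro n h1 h2
        omega
      simp only [this, Set.indicator_univ, Pi.one_apply, one_mul, zero_add]
      exact lintegral_walkLaw_zero K x _
    | succ j ih =>
      intro k
      rw [show j + 1 + k = j + (k + 1) by omega, ← ih (k + 1)]
      let A : Set (Finset.Iic j → V) := {z | ∀ n : Finset.Iic j, 0 < n.1 → z n ≠ v}
      have hA : MeasurableSet A := by
        have : A = ⋂ n : Finset.Iic j, {z | 0 < n.1 → z n ≠ v} := by
          ext z; simp [A]
        rw [this]
        refine MeasurableSet.iInter fun n => ?_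
        by_cases hn : 0 < n.1
        · simp only [hn, true_imp_iff]
          exact measurableSet_preimage (t := {y | y ≠ v}) (measurable_pi_apply n)
            MeasurableSet.of_discrete
        · simp [hn]
      have hAind : ∀ X : ℕ → V, {X : ℕ → V | ∀ n, 0 < n → n ≤ j → X n ≠ v}.indicator
          (1 : (ℕ → V) → ℝ≥0∞) X = A.indicator 1 (Preorder.frestrictLe j X) := by
        intro X
        simp only [Set.indicator_apply]
        refine if_congr ?_ rfl rfl
        constructor
        · intro h n hn
          exact h n.1 hn (Finset.mem_Iic.1 n.2)
        · intro h n hn hnj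
          exact h ⟨n, Finset.mem_Iic.2 hnj⟩ hn
      have hsucc : ∀ X : ℕ → V, {X : ℕ → V | ∀ n, 0 < n → n ≤ j + 1 → X n ≠ v}.indicator
          (1 : (ℕ → V) → ℝ≥0∞) X * avoidProb K v k (X (j + 1)) =
          A.indicator 1 (Preorder.frestrictLe j X) *
            (if X (j + 1) = v then 0 else avoidProb K v k (X (j + 1))) := by
        intro X
        rw [← hAind]
        simp only [Set.indicator_apply, Set.mem_ofPred_eq, Pi.one_apply]
        have hiff : (∀ n, 0 < n → n ≤ j + 1 → X n ≠ v) ↔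
            (∀ n, 0 < n → n ≤ j → X n ≠ v) ∧ X (j + 1) ≠ v := by
          constructor
          · exact fun h => ⟨fun n h1 h2 => h n h1 (by omega), h (j + 1) (by omega) le_rfl⟩
          · rintro ⟨h, h'⟩ n h1 h2
            rcases Nat.lt_or_ge j n with h3 | h3
            · obtain rfl : n = j + 1 := by omega
              exact h'
            · exact h n h1 h3
        by_cases h1 : X (j + 1) = v <;> simp [hiff, h1]
      simp_rw [hsucc, hAind]
      exact lintegral_walkLaw_succ K x j (measurable_one.indicator hA)
        fun y => if y = v then 0 else avoidProb K v k y
  have hN : MeasurableSet {X : ℕ → V | ∀ n, 0 < n → n ≤ N → X n ≠ v} := by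
    simp only [Set.ofPred_forall]
    refine MeasurableSet.iInter fun n => MeasurableSet.iInter fun _ => MeasurableSet.iInter fun _ =>
      measurableSet_preimage (t := {y | y ≠ v}) (measurable_pi_apply n) MeasurableSet.of_discrete
  rw [← lintegral_indicator_one hN, ← add_zero N, ← key N 0]
  simp [avoidProb]

lemma avoidProb_le_one (K : V → PMF V) (v : V) (N : ℕ) (x : V) : avoidProb K v N x ≤ 1 := by
  let _ : MeasurableSpace V := ⊤
  rw [← walkLaw_avoid]
  have : IsProbabilityMeasure (walkLaw K x) := by unfold walkLaw; infer_instance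
  exact prob_le_one

lemma antitone_avoidProb (K : V → PMF V) (v x : V) : Antitone fun N => avoidProb K v N x := by
  let _ : MeasurableSpace V := ⊤
  intro M N h
  simp only [← walkLaw_avoid]
  exact measure_mono fun X hX n h1 h2 => hX n h1 (h2.trans h)

lemma isRecurrent_of_avoidProb {K : V → PMF V}
    (h : ∀ v, Tendsto (fun N => avoidProb K v N v) atTop (𝓝 0)) : IsRecurrent K := by
  let _ : MeasurableSpace V := ⊤
  intro v
  rw [ae_iff]
  refine le_antisymm (ge_of_tendsto' (h v) fun N => ?_) (zero_le)
  rw [← walkLaw_avoid]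
  refine measure_mono fun X hX n h1 _ => ?_
  simp only [Set.mem_ofPred_eq, not_exists, not_and] at hX
  exact hX n h1

/-- A Markov chain is recurrent if its nonnegative superharmonic functions are constant: the
probability of reaching a given vertex is one of them, and equals one at that vertex. -/
theorem isRecurrent_of_superharmonic_const {G : SimpleGraph V} [G.LocallyFinite] {K : V → PMF V}
    (hK : ∀ v, (K v).support = G.neighborSet v)
    (hconst : ∀ f : V → ℝ, (∀ σ, 0 ≤ f σ) →
      (∀ σ, ∑ τ ∈ G.neighborFinset σ, (K σ τ).toReal * f τ ≤ f σ) → ∀ σ τ, f σ = f τ) :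
    IsRecurrent K := by
  classical
  refine isRecurrent_of_avoidProb fun v => ?_
  let b : ℕ → V → ℝ := fun N x => (avoidProb K v N x).toReal
  have hb0 : ∀ N x, 0 ≤ b N x := fun N x => ENNReal.toReal_nonneg
  have hb1 : ∀ N x, b N x ≤ 1 := fun N x =>
    ENNReal.toReal_le_of_le_ofReal zero_le_one (by simpa using avoidProb_le_one K v N x)
  have hne : ∀ N x, avoidProb K v N x ≠ ∞ := fun N x =>
    ((avoidProb_le_one K v N x).trans_lt ENNReal.one_lt_top).ne
  have hanti : ∀ x, Antitone fun N => b N x := fun x M N h =>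
    ENNReal.toReal_mono (hne _ _) (antitone_avoidProb K v x h)
  have htsum : ∀ x (F : V → ℝ≥0∞), ∑' y, K x y * F y = ∑ y ∈ G.neighborFinset x, K x y * F y := by
    intro x F
    refine tsum_eq_sum fun y hy => ?_
    have : y ∉ (K x).support := by
      rw [hK]; simpa using hy
    rw [(PMF.apply_eq_zero_iff _ _).2 this, zero_mul]
  have hbsucc : ∀ N x, b (N + 1) x =
      ∑ y ∈ G.neighborFinset x, (K x y).toReal * if y = v then 0 else b N y := by
    intro N x
    simp only [b]
    rw [avoidProb, htsum, ENNReal.toReal_sum]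
    · refine Finset.sum_congr rfl fun y _ => ?_
      rw [ENNReal.toReal_mul]
      split_ifs <;> simp
    · intro y _
      refine ENNReal.mul_ne_top (PMF.apply_ne_top _ _) ?_
      split_ifs
      · simp
      · exact hne _ _
  have hk1 : ∀ x, ∑ y ∈ G.neighborFinset x, (K x y).toReal = 1 := by
    intro x
    have h1 := htsum x fun _ => 1
    simp only [mul_one, PMF.tsum_coe] at h1
    rw [← ENNReal.toReal_sum fun y _ => PMF.apply_ne_top _ _, ← h1, ENNReal.toReal_one]
  -- the probability of never hitting `v` at a positive time
  let a : V → ℝ := fun x => ⨅ N, b N x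
  have hbdd : ∀ x, BddBelow (Set.range fun N => b N x) := fun x =>
    ⟨0, by rintro _ ⟨N, rfl⟩; exact hb0 N x⟩
  have ha : ∀ x, Tendsto (fun N => b N x) atTop (𝓝 (a x)) := fun x =>
    tendsto_atTop_ciInf (hanti x) (hbdd x)
  have ha0 : ∀ x, 0 ≤ a x := fun x => le_ciInf fun N => hb0 N x
  have ha1 : ∀ x, a x ≤ 1 := fun x => (ciInf_le (hbdd x) 0).trans (hb1 0 x)
  let g : V → ℝ := fun y => if y = v then 0 else a y
  have hag : ∀ x, a x = ∑ y ∈ G.neighborFinset x, (K x y).toReal * g y := by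
    intro x
    have h1 := (tendsto_add_atTop_iff_nat 1).2 (ha x)
    simp_rw [hbsucc] at h1
    refine tendsto_nhds_unique h1 (tendsto_finsetSum _ fun y _ => Tendsto.const_mul _ ?_)
    by_cases hy : y = v
    · simp [g, hy]
    · simpa [g, hy] using ha y
  have hg1 : ∀ y, g y ≤ 1 := by
    intro y
    simp only [g]
    split_ifs
    · exact zero_le_one
    · exact ha1 y
  have hga : ∀ y, g y ≤ a y := by
    intro y
    simp only [g]
    split_ifs
    · exact ha0 y
    · exact le_rfl
  have hg : ∀ y, g y = 0 := by
    intro y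
    have h1 := hconst (fun y => 1 - g y) (fun y => sub_nonneg.2 (hg1 y)) (fun x => by
      simp_rw [mul_sub, mul_one, Finset.sum_sub_distrib, hk1, ← hag]
      linarith [hga x]) y v
    have h2 : g v = 0 := by simp [g]
    simp only [h2] at h1
    linarith
  have hav : a v = 0 := by
    rw [hag]
    simp [hg]
  have h1 := ha v
  rw [hav] at h1
  have h2 := (ENNReal.tendsto_toReal_iff (fun N => hne N v) ENNReal.zero_ne_top).1
    (by simpa [b] using h1)
  exact h2

end Walk

/-! ### Moments of the conductances -/


section Moments

lemma measurable_ofReal_rpow (x : ℝ) : Measurable fun a : ℝ => ENNReal.ofReal (a ^ x) := by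
  fun_prop

lemma minMoment_le_one (ν : Measure ℝ) [IsProbabilityMeasure ν] : minMoment ν ≤ 1 := by
  refine (iInf₂_le (0 : ℝ) ⟨le_rfl, zero_le_one⟩).trans_eq ?_
  simp [moment]

lemma moment_ne_zero {ν : Measure ℝ} [IsProbabilityMeasure ν] (hν : ∀ᵐ a ∂ν, 0 < a) (x : ℝ) :
    moment ν x ≠ 0 := by
  intro h
  rw [moment, lintegral_eq_zero_iff (measurable_ofReal_rpow x)] at h
  obtain ⟨a, h1, h2⟩ := (hν.and h).exists
  rw [Pi.zero_apply, ENNReal.ofReal_eq_zero] at h2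
  exact absurd (Real.rpow_pos_of_pos h1 x) h2.not_gt

variable {V : Type*} (G : SimpleGraph V) (o : V)

open Classical in
/-- The `x`-th power of the ratio `A_τ`, as a function of the vector of transition probabilities
at the parent of `τ`; it is replaced by `1` if `τ` belongs to the finite set `F` of exceptions. -/
noncomputable def factorPow (F : Finset V) (x : ℝ) (τ : V) (k : V → ℝ≥0∞) : ℝ≥0∞ :=
  if τ ∈ F then 1
  else ENNReal.ofReal ((k τ / k (parent G o (parent G o τ))).toReal ^ x)

/-- The `x`-th power of the conductance of the edge that precedes `σ`, without the factors from the
finite set `F` of exceptions. -/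
noncomputable def conductancePow (F : Finset V) (x : ℝ) (K : V → PMF V) (σ : V) : ℝ≥0∞ :=
  ∏ i ∈ Finset.range (G.dist o σ),
    factorPow G o F x ((parent G o)^[i] σ) (fun w => K ((parent G o)^[i + 1] σ) w)

variable {G o}

lemma measurable_factorPow (F : Finset V) (x : ℝ) (τ : V) :
    Measurable (factorPow G o F x τ) := by
  unfold factorPow
  split_ifs
  · exact measurable_const
  · refine (measurable_ofReal_rpow x).comp (ENNReal.measurable_toReal.comp ?_)
    exact (measurable_pi_apply _).div (measurable_pi_apply _)

variable {Ω : Type*} [MeasurableSpace Ω] {μ : Measure Ω} {P : Ω → V → PMF V} {ν : Measure ℝ}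

lemma measurable_conductancePow (hP : IsRandomEnvironment G o μ P ν) (F : Finset V) (x : ℝ)
    (σ : V) : Measurable fun ω => conductancePow G o F x (P ω) σ := by
  unfold conductancePow
  refine Finset.measurable_fun_prod _ fun i _ => (measurable_factorPow F x _).comp ?_
  exact measurable_pi_lambda _ fun w => hP.measurable _ w

lemma lintegral_conductancePow (hG : G.IsTree) (hP : IsRandomEnvironment G o μ P ν)
    (F : Finset V) (x : ℝ) (σ : V) :
    ∫⁻ ω, conductancePow G o F x (P ω) σ ∂μ = ∏ i ∈ Finset.range (G.dist o σ),
      ∫⁻ ω, factorPow G o F x ((parent G o)^[i] σ)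
        (fun w => P ω ((parent G o)^[i + 1] σ) w) ∂μ := by
  -- the factors involve the transition probabilities at distinct ancestors of `σ`
  have hinj : Function.Injective fun i : Fin (G.dist o σ) => (parent G o)^[i.1 + 1] σ := by
    intro i j h
    have := iterate_parent_injOn hG σ (by omega) (by omega) h
    exact Fin.ext (by omega)
  have hind := (hP.indep.precomp hinj).comp
    (fun i : Fin (G.dist o σ) => factorPow G o F x ((parent G o)^[i.1] σ))
    fun i => measurable_factorPow F x _
  have := lintegral_prod_eq_prod_lintegral_of_indepFun Finset.univ _ hind fun i =>
    (measurable_factorPow F x _).comp (measurable_pi_lambda _ fun w => hP.measurable _ w)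
  rw [Finset.prod_range]
  simpa only [conductancePow, Finset.prod_range, Function.comp_apply] using this

lemma pow_card_mul_lintegral_conductancePow_le (hG : G.IsTree) [IsProbabilityMeasure μ]
    (hP : IsRandomEnvironment G o μ P ν) {F : Finset V} {x : ℝ} {p : ℝ≥0∞} (hp : moment ν x = p)
    (hp1 : p ≤ 1)
    (hF : ∀ τ, τ ≠ o → τ ∉ F → HasLaw (fun ω => envRatio G o (P ω) τ) ν μ) (σ : V) :
    p ^ F.card * ∫⁻ ω, conductancePow G o F x (P ω) σ ∂μ ≤ p ^ G.dist o σ := by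
  classical
  have hfac : ∀ i ∈ Finset.range (G.dist o σ), ∫⁻ ω, factorPow G o F x ((parent G o)^[i] σ)
      (fun w => P ω ((parent G o)^[i + 1] σ) w) ∂μ =
      if (parent G o)^[i] σ ∈ F then 1 else p := by
    intro i hi
    rw [Finset.mem_range] at hi
    unfold factorPow
    split_ifs with h
    · simp
    · have hne := iterate_parent_ne_root (o := o) hG hi
      rw [← hp, moment, ← (hF _ hne h).lintegral_comp (measurable_ofReal_rpow x).aemeasurable]
      simp only [envRatio, Function.iterate_succ_apply']
  rw [lintegral_conductancePow hG hP, Finset.prod_congr rfl hfac, Finset.prod_ite,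
    Finset.prod_const_one, one_mul, Finset.prod_const]
  have hcard : (Finset.range (G.dist o σ) |>.filter fun i => (parent G o)^[i] σ ∈ F).card ≤
      F.card := by
    refine Finset.card_le_card_of_injOn (fun i => (parent G o)^[i] σ)
      (fun i hi => (Finset.mem_filter.1 hi).2) ?_
    intro i hi j hj h
    have h1 := Finset.mem_range.1 (Finset.mem_filter.1 hi).1
    have h2 := Finset.mem_range.1 (Finset.mem_filter.1 hj).1
    exact iterate_parent_injOn hG σ h1.le h2.le h
  have hsum := Finset.card_filter_add_card_filter_not (s := Finset.range (G.dist o σ))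
    (fun i => (parent G o)^[i] σ ∈ F)
  rw [Finset.card_range] at hsum
  rw [← pow_add]
  exact pow_le_pow_right_of_le_one' hp1 (by omega)

/-- Along a random subsequence of the cutsets, the sums of the `x`-th powers of the conductances
are bounded. -/
lemma ae_frequently_sum_conductancePow_le (hG : G.IsTree) [IsProbabilityMeasure μ]
    (hP : IsRandomEnvironment G o μ P ν) {F : Finset V} {x : ℝ} {p : ℝ≥0∞} (hp : moment ν x = p)
    (hp0 : p ≠ 0) (hp1 : p ≤ 1)
    (hF : ∀ τ, τ ≠ o → τ ∉ F → HasLaw (fun ω => envRatio G o (P ω) τ) ν μ)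
    (S : ℕ → Finset V) (hsum : (⨆ n, ∑ σ ∈ S n, p ^ G.dist o σ) < ∞) :
    ∀ᵐ ω ∂μ, ∃ M < ∞, ∃ᶠ n in atTop, ∑ σ ∈ S n, conductancePow G o F x (P ω) σ ≤ M := by
  have hmeas : ∀ n, Measurable fun ω => ∑ σ ∈ S n, conductancePow G o F x (P ω) σ := fun n =>
    Finset.measurable_fun_sum _ fun σ _ => measurable_conductancePow hP F x σ
  have hpow0 : p ^ F.card ≠ 0 := pow_ne_zero _ hp0
  have hpowtop : p ^ F.card ≠ ∞ := ENNReal.pow_ne_top (hp1.trans_lt ENNReal.one_lt_top).ne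
  have hbound : ∀ n, ∫⁻ ω, ∑ σ ∈ S n, conductancePow G o F x (P ω) σ ∂μ ≤
      (p ^ F.card)⁻¹ * ⨆ n, ∑ σ ∈ S n, p ^ G.dist o σ := by
    intro n
    rw [lintegral_finsetSum _ fun σ _ => measurable_conductancePow hP F x σ,
      ← ENNReal.mul_le_iff_le_inv hpow0 hpowtop, Finset.mul_sum]
    refine (Finset.sum_le_sum fun σ _ =>
      pow_card_mul_lintegral_conductancePow_le hG hP hp hp1 hF σ).trans ?_
    exact le_iSup (fun n => ∑ σ ∈ S n, p ^ G.dist o σ) n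
  have hlim : ∫⁻ ω, liminf (fun n => ∑ σ ∈ S n, conductancePow G o F x (P ω) σ) atTop ∂μ < ∞ := by
    refine (lintegral_liminf_le hmeas).trans_lt ?_
    refine lt_of_le_of_lt (liminf_le_of_frequently_le' (Frequently.of_forall hbound)) ?_
    exact ENNReal.mul_lt_top (ENNReal.inv_lt_top.2 (pos_iff_ne_zero.2 hpow0)) hsum
  filter_upwards [ae_lt_top (Measurable.liminf hmeas) hlim.ne] with ω hω
  obtain ⟨M, hM1, hM2⟩ := exists_between hω
  exact ⟨M, hM2, (frequently_lt_of_liminf_lt (by isBoundedDefault) hM1).mono fun n hn => hn.le⟩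

end Moments

/-! ### Conductances in a fixed environment -/

section Conductance

variable {V : Type*} {G : SimpleGraph V} {o : V} {K : V → PMF V} {B : V → ℝ}

lemma toReal_pos_of_adj (hK : ∀ v, (K v).support = G.neighborSet v) {v w : V} (h : G.Adj v w) :
    0 < (K v w).toReal := by
  have : w ∈ (K v).support := by rw [hK]; exact h
  exact ENNReal.toReal_pos ((PMF.mem_support_iff _ _).1 this) (PMF.apply_ne_top _ _)

lemma envRatio_pos (hG : G.IsTree) (hK : ∀ v, (K v).support = G.neighborSet v) {σ : V}
    (hσ : 2 ≤ G.dist o σ) : 0 < envRatio G o K σ := by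
  have h1 : σ ≠ o := by rintro rfl; simp at hσ
  have h2 := parent_spec hG h1
  have h3 : parent G o σ ≠ o := by
    intro h; rw [h, G.dist_self] at h2; omega
  rw [envRatio, ENNReal.toReal_div]
  exact div_pos (toReal_pos_of_adj hK h2.1.symm) (toReal_pos_of_adj hK (parent_spec hG h3).1)

lemma edgeFactor_pos (hG : G.IsTree) (hK : ∀ v, (K v).support = G.neighborSet v)
    (hB : ∀ σ, G.dist o σ = 1 → 0 < B σ) {σ : V} (hσ : σ ≠ o) : 0 < edgeFactor G o K B σ := by
  rw [edgeFactor]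
  split_ifs with h
  · exact hB σ h
  · have : G.dist o σ ≠ 0 := fun h0 => hσ ((dist_eq_zero_iff_eq_root hG).1 h0)
    exact envRatio_pos hG hK (by omega)

lemma conductance_pos (hG : G.IsTree) (hK : ∀ v, (K v).support = G.neighborSet v)
    (hB : ∀ σ, G.dist o σ = 1 → 0 < B σ) (σ : V) : 0 < conductance G o K B σ :=
  Finset.prod_pos fun _ hi =>
    edgeFactor_pos hG hK hB (iterate_parent_ne_root hG (Finset.mem_range.1 hi))

/-- Away from the root, the transition probabilities are proportional to the conductances. -/
lemma conductance_mul_transition [G.LocallyFinite] (hG : G.IsTree)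
    (hK : ∀ v, (K v).support = G.neighborSet v) {σ : V} (hσ : σ ≠ o) {τ : V}
    (hτ : τ ∈ successors G o σ) :
    conductance G o K B τ * (K σ (parent G o σ)).toReal =
      conductance G o K B σ * (K σ τ).toReal := by
  have hd := (mem_successors.1 hτ).2
  have hσ0 : G.dist o σ ≠ 0 := fun h0 => hσ ((dist_eq_zero_iff_eq_root hG).1 h0)
  have h : conductance G o K B τ = conductance G o K B σ * envRatio G o K τ := by
    rw [conductance, hd, Finset.prod_range_succ', conductance]
    congr 1
    · refine Finset.prod_congr rfl fun i _ => ?_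
      rw [Function.iterate_succ_apply, parent_of_mem_successors hG hτ]
    · rw [Function.iterate_zero, id, edgeFactor, if_neg (by omega)]
  have hpos := toReal_pos_of_adj hK (parent_spec hG hσ).1
  rw [h, envRatio, parent_of_mem_successors hG hτ, ENNReal.toReal_div]
  field_simp

lemma rpow_sum_le_sum_rpow {ι : Type*} (s : Finset ι) {f : ι → ℝ} (hf : ∀ i ∈ s, 0 ≤ f i) {x : ℝ}
    (hx0 : 0 < x) (hx1 : x ≤ 1) : (∑ i ∈ s, f i) ^ x ≤ ∑ i ∈ s, f i ^ x := by
  classical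
  induction s using Finset.induction_on with
  | empty => simp [Real.zero_rpow hx0.ne']
  | insert i s hi ih =>
    rw [Finset.sum_insert hi, Finset.sum_insert hi]
    have h1 : ∀ j ∈ s, 0 ≤ f j := fun j hj => hf j (Finset.mem_insert_of_mem hj)
    refine (Real.rpow_add_le_add_rpow (hf i (Finset.mem_insert_self _ _)) (Finset.sum_nonneg h1)
      hx0.le hx1).trans ?_
    gcongr
    exact ih h1

/-- The finitely many exceptional factors change the conductances by a bounded factor only. -/
lemma exists_rpow_conductance_le (hG : G.IsTree) (hK : ∀ v, (K v).support = G.neighborSet v)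
    (hB : ∀ σ, G.dist o σ = 1 → 0 < B σ) {F : Finset V}
    (hF1 : ∀ τ, G.dist o τ = 1 → τ ∈ F) (x : ℝ) :
    ∃ L : ℝ, 0 ≤ L ∧ ∀ σ, ENNReal.ofReal (conductance G o K B σ ^ x) ≤
      ENNReal.ofReal L * conductancePow G o F x K σ := by
  classical
  let l : V → ℝ := fun τ => if τ ∈ F then max 1 (edgeFactor G o K B τ ^ x) else 1
  have hl1 : ∀ τ, 1 ≤ l τ := by
    intro τ
    simp only [l]
    split_ifs
    · exact le_max_left _ _
    · exact le_rfl
  have hl0 : ∀ τ, 0 ≤ l τ := fun τ => zero_le_one.trans (hl1 τ)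
  have hone : ∀ s : Finset V, 1 ≤ ∏ τ ∈ s, l τ := fun s => by
    simpa using Finset.prod_le_prod (s := s) (f := fun _ => (1 : ℝ)) (g := l)
      (fun _ _ => zero_le_one) fun τ _ => hl1 τ
  refine ⟨∏ τ ∈ F, l τ, zero_le_one.trans (hone F), fun σ => ?_⟩
  have hprod : ∏ i ∈ Finset.range (G.dist o σ), l ((parent G o)^[i] σ) ≤ ∏ τ ∈ F, l τ := by
    set I := (Finset.range (G.dist o σ)).image fun i => (parent G o)^[i] σ with hI
    have h1 : ∏ i ∈ Finset.range (G.dist o σ), l ((parent G o)^[i] σ) = ∏ τ ∈ I, l τ := by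
      rw [hI, Finset.prod_image]
      intro i hi j hj h
      exact iterate_parent_injOn hG σ (Finset.mem_range.1 hi).le (Finset.mem_range.1 hj).le h
    have h2 : ∏ τ ∈ F, l τ = ∏ τ ∈ I ∪ F, l τ :=
      Finset.prod_subset Finset.subset_union_right fun τ _ hτ => by simp [l, hτ]
    rw [h1, h2, ← Finset.prod_sdiff (Finset.subset_union_left (s₁ := I) (s₂ := F))]
    exact le_mul_of_one_le_left (Finset.prod_nonneg fun τ _ => hl0 τ) (hone _)
  have hfac : ∀ i ∈ Finset.range (G.dist o σ),
      ENNReal.ofReal (edgeFactor G o K B ((parent G o)^[i] σ) ^ x) ≤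
      ENNReal.ofReal (l ((parent G o)^[i] σ)) *
        factorPow G o F x ((parent G o)^[i] σ) (fun w => K ((parent G o)^[i + 1] σ) w) := by
    intro i _
    by_cases h : (parent G o)^[i] σ ∈ F
    · simp only [factorPow, l, if_pos h, mul_one]
      exact ENNReal.ofReal_le_ofReal (le_max_right _ _)
    · simp only [factorPow, l, if_neg h, ENNReal.ofReal_one, one_mul]
      rw [edgeFactor, if_neg fun h1 => h (hF1 _ h1), envRatio, Function.iterate_succ_apply']
  have hpos : ∀ i ∈ Finset.range (G.dist o σ), 0 ≤ edgeFactor G o K B ((parent G o)^[i] σ) :=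
    fun i hi => (edgeFactor_pos hG hK hB (iterate_parent_ne_root hG (Finset.mem_range.1 hi))).le
  calc ENNReal.ofReal (conductance G o K B σ ^ x)
      = ∏ i ∈ Finset.range (G.dist o σ),
          ENNReal.ofReal (edgeFactor G o K B ((parent G o)^[i] σ) ^ x) := by
        rw [conductance, ← Real.finsetProd_rpow _ _ hpos,
          ENNReal.ofReal_prod_of_nonneg fun i hi => Real.rpow_nonneg (hpos i hi) x]
    _ ≤ ∏ i ∈ Finset.range (G.dist o σ), (ENNReal.ofReal (l ((parent G o)^[i] σ)) *
          factorPow G o F x ((parent G o)^[i] σ) (fun w => K ((parent G o)^[i + 1] σ) w)) :=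
        Finset.prod_le_prod' hfac
    _ = ENNReal.ofReal (∏ i ∈ Finset.range (G.dist o σ), l ((parent G o)^[i] σ)) *
          conductancePow G o F x K σ := by
        rw [Finset.prod_mul_distrib, ENNReal.ofReal_prod_of_nonneg fun i _ => hl0 _]
        rfl
    _ ≤ _ := by gcongr

lemma exists_frequently_sum_conductance_le (hG : G.IsTree)
    (hK : ∀ v, (K v).support = G.neighborSet v) (hB : ∀ σ, G.dist o σ = 1 → 0 < B σ)
    {F : Finset V} (hF1 : ∀ τ, G.dist o τ = 1 → τ ∈ F) {x : ℝ} (hx0 : 0 < x) (hx1 : x ≤ 1)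
    {S : ℕ → Finset V} {M : ℝ≥0∞} (hM : M < ∞)
    (h : ∃ᶠ n in atTop, ∑ σ ∈ S n, conductancePow G o F x K σ ≤ M) :
    ∃ M' : ℝ, ∃ᶠ n in atTop, ∑ σ ∈ S n, conductance G o K B σ ≤ M' := by
  obtain ⟨L, hL0, hL⟩ := exists_rpow_conductance_le hG hK hB hF1 x
  refine ⟨(L * M.toReal) ^ x⁻¹, h.mono fun n hn => ?_⟩
  have hC := conductance_pos hG hK hB
  have hsum0 : 0 ≤ ∑ σ ∈ S n, conductance G o K B σ := Finset.sum_nonneg fun σ _ => (hC σ).le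
  have hLM : 0 ≤ L * M.toReal := mul_nonneg hL0 ENNReal.toReal_nonneg
  rw [Real.le_rpow_inv_iff_of_pos hsum0 hLM hx0]
  refine (rpow_sum_le_sum_rpow _ (fun σ _ => (hC σ).le) hx0 hx1).trans ?_
  rw [← ENNReal.ofReal_le_ofReal_iff hLM,
    ENNReal.ofReal_sum_of_nonneg fun σ _ => Real.rpow_nonneg (hC σ).le x,
    ENNReal.ofReal_mul hL0, ENNReal.ofReal_toReal hM.ne]
  refine (Finset.sum_le_sum fun σ _ => hL σ).trans ?_
  rw [← Finset.mul_sum]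
  gcongr

end Conductance

end TreeRWRE

/-! ### Recurrence of the walk in a random environment -/

theorem proposition2 {V : Type*} [Infinite V] (G : SimpleGraph V) [G.LocallyFinite]
    (hG : G.IsTree) (o : V)
    {Ω : Type*} [MeasurableSpace Ω] (μ : Measure Ω) [IsProbabilityMeasure μ]
    (P : Ω → V → PMF V) (ν : Measure ℝ) [IsProbabilityMeasure ν]
    (hν : ∀ᵐ a ∂ν, 0 < a)
    (hP : TreeRWRE.IsRandomEnvironment G o μ P ν)
    (hmin : ∃ x : ℝ, 0 < x ∧ x ≤ 1 ∧ TreeRWRE.moment ν x = TreeRWRE.minMoment ν)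
    (S : ℕ → Finset V)
    (hcut : ∀ n, TreeRWRE.IsCutset G o (S n))
    (hfar : ∀ m : ℕ, ∀ᶠ n in atTop, ∀ σ ∈ S n, m ≤ G.dist o σ)
    (hsum : (⨆ n, ∑ σ ∈ S n, TreeRWRE.minMoment ν ^ G.dist o σ) < ∞) :
    (∀ᵐ ω ∂μ, TreeRWRE.IsRecurrent (P ω)) ∧
    ∀ B : V → Ω → ℝ, (∀ᵐ ω ∂μ, ∀ σ, G.dist o σ = 1 → 0 < B σ ω) →
      ∀ᵐ ω ∂μ, TreeRWRE.HasConductanceToInfinity G o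
        (TreeRWRE.conductance G o (P ω) (fun σ => B σ ω)) 0 := by
  classical
  open TreeRWRE in
  obtain ⟨x, hx0, hx1, hx⟩ := hmin
  let F : Finset V := level G o 1 ∪ hP.law.toFinset
  have hF1 : ∀ τ, G.dist o τ = 1 → τ ∈ F := fun τ hτ =>
    Finset.mem_union_left _ ((mem_level hG).2 hτ)
  have hF : ∀ τ, τ ≠ o → τ ∉ F → HasLaw (fun ω => envRatio G o (P ω) τ) ν μ := by
    intro τ hτo hτ
    have h0 : G.dist o τ ≠ 0 := fun h => hτo ((dist_eq_zero_iff_eq_root hG).1 h)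
    have h1 : G.dist o τ ≠ 1 := fun h => hτ (hF1 τ h)
    by_contra hlaw
    refine hτ (Finset.mem_union_right _ (hP.law.mem_toFinset.2 ⟨by omega, hlaw⟩))
  have hbdd := ae_frequently_sum_conductancePow_le hG hP hx (hx ▸ moment_ne_zero hν x)
    (minMoment_le_one ν) hF S hsum
  have hzero : ∀ B : V → Ω → ℝ, (∀ᵐ ω ∂μ, ∀ σ, G.dist o σ = 1 → 0 < B σ ω) → ∀ᵐ ω ∂μ,
      (∀ σ, 0 < conductance G o (P ω) (fun σ => B σ ω) σ) ∧
      Tendsto (fun n => downConductance G o (conductance G o (P ω) (fun σ => B σ ω)) n o)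
        atTop (𝓝 0) := by
    intro B hB
    filter_upwards [hB, hP.support_eq, hbdd] with ω hBω hK hM
    obtain ⟨M, hM, hfreq⟩ := hM
    obtain ⟨M', hM'⟩ := exists_frequently_sum_conductance_le hG hK hBω hF1 hx0 hx1 hM hfreq
    have hC := conductance_pos hG hK hBω
    exact ⟨hC, tendsto_downConductance_root hG (fun σ _ => hC σ) hcut hfar hM'⟩
  refine ⟨?_, fun B hB => ?_⟩
  · -- the walk does not depend on the conductances at level one, which may be taken to be `1`
    filter_upwards [hP.support_eq, hzero (fun _ _ => 1) (by simp)] with ω hK hω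
    refine isRecurrent_of_superharmonic_const hK fun f hf0 hf σ τ => ?_
    have hconst := eq_root_of_superharmonic hG (fun σ _ => hω.1 σ) hω.2
      (fun σ τ h => toReal_pos_of_adj hK h) (fun σ => ?_)
      (fun σ hσ τ hτ => conductance_mul_transition hG hK hσ hτ) hf0 hf
    · rw [hconst σ, hconst τ]
    · rw [← ENNReal.toReal_sum fun y _ => PMF.apply_ne_top _ _, ← ENNReal.toReal_one,
        ← PMF.tsum_coe (P ω σ)]
      congr 1
      refine (tsum_eq_sum fun y hy => ?_).symm
      rw [PMF.apply_eq_zero_iff, hK]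
      simpa using hy
  · filter_upwards [hzero B hB] with ω hω
    exact hasConductanceToInfinity_zero hG (fun σ _ => hω.1 σ) hω.2
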